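/- Let $G=(X,Y,E)$ be a simple bipartite $d$-regular graph on $n$ vertices, with parts $X$ and $Y$, where $1\le d\le n/4$. Let $\lambda_1\ge\lambda_2\ge\dots\ge\lambda_n$ be the eigenvalues of its adjacency matrix, with multiplicity, and let $\lambda=\max\{\lambda_2,|\lambda_{n-1}|\}$ be the third largest eigenvalue in absolute value. For nonnegative integers $k,t$, let $BGP_{k,t}(G)$ be the bipartite graph with parts $X^k$ and $Y^k$ in which $(x_1,\dots,x_k)\in X^k$ and $(y_1,\dots,y_k)\in Y^k$ are adjacent if and only if at least $t$ of the pairs $(x_i,y_i)$ are edges of $G$. Then $BGP_{k,t}(G)$ is $d_2$-regular, where $$d_2=\sum_{t'=t}^{k}\binom{k}{t'}d^{t'}\Bigl(\frac n2-d\Bigr)^{k-t'},$$ and for any two sets of vertices $S\subseteq X^k$ and $T\subseteq Y^k$, $$\left|e(S,T)-\mu_{S,T}\right|\le\frac{\lambda}{d}\cdot d_2\sqrt{|S||T|}.$$ Here $e(S,T)$ is the number of edges of $BGP_{k,t}(G)$ between $S$ and $T$, and $\mu_{S,T}=\dfrac{d_2|S||T|}{N/2}$, where $N=|X|^k+|Y|^k$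 is the number of vertices of $BGP_{k,t}(G)$. -/

import Mathlib

noncomputable section

namespace BipartiteProduct

/-- The eigenvalues, with multiplicity, of the adjacency matrix of a finite graph on `n` vertices,
listed in decreasing order and numbered from `0`: in the usual notation
`eigenvalue G i` is `λ_{i+1}` for `i < n`, where `λ_1 ≥ λ_2 ≥ … ≥ λ_n`.
(The value is `0` for `i ≥ n`.) -/
def eigenvalue {V : Type*} [Fintype V] [DecidableEq V] (G : SimpleGraph V) [DecidableRel G.Adj]
    (i : ℕ) : ℝ :=
  if h : i < Fintype.card V then
    Matrix.IsHermitian.eigenvalues₀ (A := G.adjMatrix ℝ) (G.isHermitian_adjMatrix (R := ℝ)) ⟨i, h⟩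
  else 0

/-- For a bipartite graph on `n` vertices with adjacency eigenvalues `λ_1 ≥ … ≥ λ_n`, this is
`λ(G) = max {λ_2, |λ_{n-1}|}`, the third largest eigenvalue in absolute value. -/
def bipartiteLambda {V : Type*} [Fintype V] [DecidableEq V] (G : SimpleGraph V)
    [DecidableRel G.Adj] : ℝ :=
  max (eigenvalue G 1) |eigenvalue G (Fintype.card V - 2)|

/-- The bipartite graph product `BGP_{k,t}(G)` of a graph `G` with parts `X` and `Y`: its parts are
`X^k` and `Y^k`, and `x ∈ X^k`, `y ∈ Y^k` are adjacent iff at least `t` of the pairs `(x_i, y_i)`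
are edges of `G`. -/
def bgp {X Y : Type*} (G : SimpleGraph (X ⊕ Y)) [DecidableRel G.Adj] (k t : ℕ) :
    SimpleGraph ((Fin k → X) ⊕ (Fin k → Y)) where
  Adj
    | .inl x, .inr y =>
        t ≤ (Finset.univ.filter fun i : Fin k => G.Adj (.inl (x i)) (.inr (y i))).card
    | .inr y, .inl x =>
        t ≤ (Finset.univ.filter fun i : Fin k => G.Adj (.inl (x i)) (.inr (y i))).card
    | .inl _, .inl _ => False
    | .inr _, .inr _ => False
  symm := ⟨by
    rintro (x | y) (x' | y') h
    · exact h
    · exact h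
    · exact h
    · exact h⟩
  loopless := ⟨by
    rintro (x | y) h
    · exact h
    · exact h⟩

instance bgpDecidableAdj {X Y : Type*} (G : SimpleGraph (X ⊕ Y)) [DecidableRel G.Adj] (k t : ℕ) :
    DecidableRel (bgp G k t).Adj :=
  Classical.decRel _

/-- `d₂ = ∑_{t'=t}^{k} (k choose t') d^{t'} (n/2 - d)^{k-t'}`. -/
def d₂ (n d k t : ℕ) : ℝ :=
  ∑ s ∈ Finset.Icc t k, (k.choose s : ℝ) * (d : ℝ) ^ s * ((n : ℝ) / 2 - (d : ℝ)) ^ (k - s)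

/-- `e(S,T)`: the number of edges between two vertex sets, an edge inside `S ∩ T` counting twice
(the number of pairs `(u, v) ∈ S × T` that are adjacent). -/
def edgeCount {V : Type*} (H : SimpleGraph V) [DecidableRel H.Adj]
    (S T : Finset V) : ℕ :=
  (H.interedges S T).card

/-- `μ_{S,T} = D |S| |T| / (N/2)`, the expected number of edges between `S` and `T`, one in each
part, in a `D`-regular bipartite graph on the `N`-element vertex set `V`. -/
def mu (V : Type*) [Fintype V] (D : ℝ) (S T : Finset V) : ℝ :=
  D * (S.card : ℝ) * (T.card : ℝ) / ((Fintype.card V : ℝ) / 2)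

end BipartiteProduct

end

/-! Put m = n/2 and let K be the biadjacency matrix minus its mean entry d/m. Rows and columns of K
sum to zero, and its norm is at most both λ and d. For a weight w on ℕ, let W_k[w] have entries
w(number of coordinates that are edges). Splitting off one coordinate gives W_{k+1}[w] = (J/m) ⊗
W_k[d w(·+1) + (m-d) w] + K ⊗ W_k[w(·+1) - w], with J all ones. The summands act on and map into
orthogonal subspaces, so the norm is the larger of the two (`OpBound.tensor`). Induction on k gives
W_k[w] minus its mean entry norm at most (λ/d) B_k(|w|), where B_k is `binomSum`: the J part
inherits the bound, and the K part costs λ B_k(|w(·+1) - w|) ≤ (λ/d) B_{k+1}(|w|), where d ≤ m-d is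
used. With w the indicator of s ≥ t, B_k is `d₂`, and Cauchy–Schwarz finishes as in the expander
mixing lemma. -/

namespace BipartiteProduct

open Finset

/-! ### Operator norm bounds and tensor products -/

/-- `A` maps functions on `β` to functions on `α` with `ℓ²` operator norm at most `|c|`. -/
def OpBound {α β : Type*} [Fintype α] [Fintype β] (A : α → β → ℝ) (c : ℝ) : Prop :=
  ∀ g : β → ℝ, ∑ x, (∑ y, A x y * g y) ^ 2 ≤ c ^ 2 * ∑ y, g y ^ 2

theorem OpBound.mono {α β : Type*} [Fintype α] [Fintype β] {A : α → β → ℝ} {c c' : ℝ}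
    (h : OpBound A c) (hc : 0 ≤ c) (hcc : c ≤ c') : OpBound A c' := fun g =>
  (h g).trans (mul_le_mul_of_nonneg_right (pow_le_pow_left₀ hc hcc 2)
    (sum_nonneg fun _ _ => sq_nonneg _))

theorem OpBound.reindex {α β α' β' : Type*} [Fintype α] [Fintype β] [Fintype α'] [Fintype β']
    {A : α → β → ℝ} {c : ℝ} (e : α' ≃ α) (f : β' ≃ β)
    (h : OpBound (fun x y => A (e x) (f y)) c) : OpBound A c := by
  intro g
  have := h (g ∘ f)
  rw [← e.sum_comp, ← f.sum_comp (fun y => g y ^ 2)]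
  simpa only [Function.comp, ← f.sum_comp (fun y => A _ y * g y)] using this

/-- Apply the bound to the indicator of T, then Cauchy–Schwarz over S. -/
theorem OpBound.abs_sum_le {α β : Type*} [Fintype α] [Fintype β] [DecidableEq β] {A : α → β → ℝ}
    {c : ℝ} (h : OpBound A c) (hc : 0 ≤ c) (S : Finset α) (T : Finset β) :
    |∑ x ∈ S, ∑ y ∈ T, A x y| ≤ c * √((#S : ℝ) * #T) := by
  have h1 := h (fun y => if y ∈ T then 1 else 0)
  simp only [mul_ite, mul_one, mul_zero, ite_pow, one_pow, ne_eq, OfNat.ofNat_ne_zero,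
    not_false_eq_true, zero_pow, sum_ite_mem, univ_inter, sum_const, nsmul_eq_mul] at h1
  have h2 : (∑ x ∈ S, ∑ y ∈ T, A x y) ^ 2 ≤ #S * ∑ x ∈ S, (∑ y ∈ T, A x y) ^ 2 :=
    sq_sum_le_card_mul_sum_sq
  have h3 : ∑ x ∈ S, (∑ y ∈ T, A x y) ^ 2 ≤ ∑ x, (∑ y ∈ T, A x y) ^ 2 :=
    sum_le_sum_of_subset_of_nonneg (subset_univ S) fun _ _ _ => sq_nonneg _
  have h4 := mul_le_mul_of_nonneg_left (h3.trans h1) (Nat.cast_nonneg (α := ℝ) #S)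
  refine abs_le_of_sq_le_sq ?_ (by positivity)
  rw [mul_pow, Real.sq_sqrt (by positivity)]
  linarith

/-- The two summands act on, and map into, orthogonal subspaces. -/
theorem OpBound.tensor {α β α' β' : Type*} [Fintype α] [Fintype β] [Fintype α'] [Fintype β']
    {K : α → β → ℝ} {C C' : α' → β' → ℝ} {m σ c c' : ℝ} (hm : 0 < m)
    (hα : (Fintype.card α : ℝ) = m) (hβ : (Fintype.card β : ℝ) = m)
    (hrow : ∀ x, ∑ y, K x y = 0) (hcol : ∀ y, ∑ x, K x y = 0)
    (hK : OpBound K σ) (hC : OpBound C c) (hC' : OpBound C' c')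
    (hσ : 0 ≤ σ * c') (hcc : σ * c' ≤ c) :
    OpBound (fun (p : α × α') (q : β × β') => 1 / m * C p.2 q.2 + K p.1 q.1 * C' p.2 q.2) c := by
  intro g
  -- Decompose g into its average over the first coordinate and a remainder. K kills the average, so
  -- only the remainder enters `q`.
  set gb : β' → ℝ := fun y' => 1 / m * ∑ y, g (y, y') with hgb
  set u : α' → ℝ := fun x' => ∑ y', C x' y' * gb y' with hu
  set q : β → α' → ℝ := fun y x' => ∑ y', C' x' y' * (g (y, y') - gb y') with hq
  set p : α → α' → ℝ := fun x x' => ∑ y, K x y * q y x' with hp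
  have hh : ∀ x x', ∑ b : β × β', (1 / m * C x' b.2 + K x b.1 * C' x' b.2) * g b
      = u x' + p x x' := by
    intro x x'
    have e1 : p x x' = ∑ y, ∑ y', K x y * C' x' y' * g (y, y') := by
      simp only [hp, hq, mul_sub, sum_sub_distrib]
      rw [← sum_mul, hrow, zero_mul, sub_zero]
      simp only [mul_sum, mul_assoc]
    have e2 : u x' = ∑ y, ∑ y', 1 / m * C x' y' * g (y, y') := by
      rw [sum_comm]
      simp only [hu, hgb, mul_sum]
      exact sum_congr rfl fun _ _ => sum_congr rfl fun _ _ => by ring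
    rw [e1, e2, Fintype.sum_prod_type, ← sum_add_distrib]
    exact sum_congr rfl fun _ _ => by
      rw [← sum_add_distrib]
      exact sum_congr rfl fun _ _ => by ring
  have hp0 : ∀ x', ∑ x, p x x' = 0 := by
    intro x'
    simp only [hp]
    rw [sum_comm]
    simp only [← sum_mul, hcol, zero_mul, sum_const_zero]
  -- Pythagoras on both sides: cross terms vanish because `p` and the remainder sum to zero over the
  -- first coordinate.
  have hL : ∑ a : α × α', (∑ b : β × β', (1 / m * C a.2 b.2 + K a.1 b.1 * C' a.2 b.2) * g b) ^ 2
      = m * ∑ x', u x' ^ 2 + ∑ x', ∑ x, p x x' ^ 2 := by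
    simp only [hh]
    rw [Fintype.sum_prod_type_right, mul_sum, ← sum_add_distrib]
    refine sum_congr rfl fun x' _ => ?_
    simp only [add_sq, sum_add_distrib, ← mul_sum, hp0, sum_const, card_univ, nsmul_eq_mul, hα]
    ring
  have hR : ∑ b : β × β', g b ^ 2
      = m * ∑ y', gb y' ^ 2 + ∑ y, ∑ y', (g (y, y') - gb y') ^ 2 := by
    rw [Fintype.sum_prod_type_right, sum_comm (s := (univ : Finset β)), mul_sum,
      ← sum_add_distrib]
    refine sum_congr rfl fun y' _ => ?_
    have : ∑ y, g (y, y') = m * gb y' := by simp only [hgb]; field_simp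
    simp only [sub_sq, sum_add_distrib, sum_sub_distrib, ← mul_sum, ← sum_mul, this, sum_const,
      card_univ, nsmul_eq_mul, hβ]
    ring
  have b1 : ∑ x', u x' ^ 2 ≤ c ^ 2 * ∑ y', gb y' ^ 2 := hC gb
  have b2 : ∑ x', ∑ x, p x x' ^ 2 ≤ σ ^ 2 * ∑ y, ∑ x', q y x' ^ 2 := by
    rw [sum_comm (s := (univ : Finset β)), mul_sum]
    exact sum_le_sum fun x' _ => hK fun y => q y x'
  have b3 : ∑ y, ∑ x', q y x' ^ 2 ≤ c' ^ 2 * ∑ y, ∑ y', (g (y, y') - gb y') ^ 2 := by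
    rw [mul_sum]
    exact sum_le_sum fun y _ => hC' fun y' => g (y, y') - gb y'
  have b4 : (σ * c') ^ 2 * ∑ y, ∑ y', (g (y, y') - gb y') ^ 2
      ≤ c ^ 2 * ∑ y, ∑ y', (g (y, y') - gb y') ^ 2 :=
    mul_le_mul_of_nonneg_right (pow_le_pow_left₀ hσ hcc 2)
      (sum_nonneg fun _ _ => sum_nonneg fun _ _ => sq_nonneg _)
  rw [hL, hR]
  have b5 := mul_le_mul_of_nonneg_left b1 hm.le
  have b6 := mul_le_mul_of_nonneg_left b3 (sq_nonneg σ)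
  rw [mul_pow] at b4
  linarith

/-! ### Weights of the hit count and binomial sums -/

/-- The number of coordinates in which `x` and `y` are related. -/
def hits {X Y : Type*} (r : X → Y → Prop) [∀ x y, Decidable (r x y)] {k : ℕ} (x : Fin k → X)
    (y : Fin k → Y) : ℕ :=
  #{i | r (x i) (y i)}

theorem hits_cons {X Y : Type*} (r : X → Y → Prop) [∀ x y, Decidable (r x y)] {k : ℕ} (a : X)
    (b : Y) (x : Fin k → X) (y : Fin k → Y) :
    hits r (Fin.cons a x : Fin (k + 1) → X) (Fin.cons b y : Fin (k + 1) → Y)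
      = hits r x y + if r a b then 1 else 0 := by
  unfold hits
  rw [Fin.card_filter_univ_succ]
  simp only [Fin.cons_zero, Fin.cons_succ]
  split_ifs <;> rfl

/-- `∑_s (k choose s) w(s) d^s e^{k-s}`, given by its recursion in `k`. -/
def binomSum (d e : ℝ) : ℕ → (ℕ → ℝ) → ℝ
  | 0, w => w 0
  | k + 1, w => d * binomSum d e k (fun s => w (s + 1)) + e * binomSum d e k w

theorem binomSum_eq_antidiagonal (d e : ℝ) (k : ℕ) (w : ℕ → ℝ) :
    binomSum d e k w
      = ∑ ij ∈ antidiagonal k, (k.choose ij.1 : ℝ) * (w ij.1 * d ^ ij.1 * e ^ ij.2) := by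
  induction k generalizing w with
  | zero => simp [binomSum]
  | succ k ih =>
    rw [sum_antidiagonal_choose_succ_mul (fun i j => w i * d ^ i * e ^ j), binomSum, ih, ih,
      mul_sum, mul_sum, add_comm]
    congr 1
    · exact sum_congr rfl fun _ _ => by ring
    · refine sum_congr rfl fun ij h => ?_
      rw [← Nat.choose_symm_of_eq_add (mem_antidiagonal.1 h).symm]
      ring

theorem d₂_eq_binomSum (n d k t : ℕ) :
    d₂ n d k t = binomSum d ((n : ℝ) / 2 - d) k (fun s => if t ≤ s then 1 else 0) := by
  rw [binomSum_eq_antidiagonal, Nat.sum_antidiagonal_eq_sum_range_succ_mk, d₂]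
  simp only [ite_mul, one_mul, zero_mul, mul_ite, mul_zero, ← sum_filter]
  refine sum_congr ?_ fun _ _ => by ring
  ext s
  simp only [mem_Icc, mem_filter, mem_range]
  omega

theorem binomSum_add (d e : ℝ) (k : ℕ) (v w : ℕ → ℝ) :
    binomSum d e k (fun s => v s + w s) = binomSum d e k v + binomSum d e k w := by
  induction k generalizing v w with
  | zero => rfl
  | succ k ih => simp only [binomSum, ih]; ring

theorem binomSum_const_mul (d e a : ℝ) (k : ℕ) (w : ℕ → ℝ) :
    binomSum d e k (fun s => a * w s) = a * binomSum d e k w := by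
  induction k generalizing w with
  | zero => rfl
  | succ k ih => simp only [binomSum, ih]; ring

theorem binomSum_mono {d e : ℝ} (hd : 0 ≤ d) (he : 0 ≤ e) (k : ℕ) {v w : ℕ → ℝ}
    (h : ∀ s, v s ≤ w s) : binomSum d e k v ≤ binomSum d e k w := by
  induction k generalizing v w with
  | zero => exact h 0
  | succ k ih =>
    exact add_le_add (mul_le_mul_of_nonneg_left (ih fun s => h (s + 1)) hd)
      (mul_le_mul_of_nonneg_left (ih h) he)

theorem binomSum_nonneg {d e : ℝ} (hd : 0 ≤ d) (he : 0 ≤ e) (k : ℕ) {w : ℕ → ℝ}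
    (h : ∀ s, 0 ≤ w s) : 0 ≤ binomSum d e k w := by
  induction k generalizing w with
  | zero => exact h 0
  | succ k ih =>
    exact add_nonneg (mul_nonneg hd (ih fun s => h (s + 1))) (mul_nonneg he (ih h))

theorem binomSum_abs_combo_le {d e : ℝ} (hd : 0 ≤ d) (he : 0 ≤ e) (k : ℕ) (w : ℕ → ℝ) :
    binomSum d e k (fun s => |d * w (s + 1) + e * w s|) ≤ binomSum d e (k + 1) (fun s => |w s|) := by
  have : binomSum d e (k + 1) (fun s => |w s|)
      = binomSum d e k (fun s => d * |w (s + 1)| + e * |w s|) := by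
    rw [binomSum_add, binomSum_const_mul, binomSum_const_mul, binomSum]
  rw [this]
  refine binomSum_mono hd he k fun s => (abs_add_le _ _).trans ?_
  rw [abs_mul, abs_mul, abs_of_nonneg hd, abs_of_nonneg he]

/-- Bound |w(s+1) - w(s)| by |w(s+1)| + |w(s)|, then raise the coefficient d of the second term to
e. This is the only loss in the K summand. -/
theorem mul_binomSum_abs_diff_le {d e : ℝ} (hd : 0 ≤ d) (hde : d ≤ e) (k : ℕ) (w : ℕ → ℝ) :
    d * binomSum d e k (fun s => |w (s + 1) - w s|) ≤ binomSum d e (k + 1) (fun s => |w s|) := by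
  have he := hd.trans hde
  have h1 : binomSum d e k (fun s => |w (s + 1) - w s|)
      ≤ binomSum d e k (fun s => |w (s + 1)|) + binomSum d e k (fun s => |w s|) := by
    rw [← binomSum_add]
    exact binomSum_mono hd he k fun s => abs_sub _ _
  have h2 := mul_le_mul_of_nonneg_left h1 hd
  have h3 := mul_le_mul_of_nonneg_right hde
    (binomSum_nonneg hd he k (w := fun s => |w s|) fun s => abs_nonneg _)
  rw [binomSum]
  linarith

/-- Of the m choices for each coordinate of y, d score a hit and m - d do not, which is the
recursion of `binomSum`. -/
theorem sum_weight_hits {X Y : Type*} [Fintype Y] (r : X → Y → Prop) [∀ x y, Decidable (r x y)]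
    {d m : ℝ} (hY : (Fintype.card Y : ℝ) = m) (hr : ∀ x, ∑ y, (if r x y then (1 : ℝ) else 0) = d)
    (k : ℕ) (w : ℕ → ℝ) (x : Fin k → X) :
    ∑ y : Fin k → Y, w (hits r x y) = binomSum d (m - d) k w := by
  induction k generalizing w with
  | zero => simp [binomSum, hits]
  | succ k ih =>
    obtain ⟨a, x, rfl⟩ : ∃ a x', x = Fin.cons a x' := ⟨x 0, Fin.tail x, (Fin.cons_self_tail x).symm⟩
    rw [← (Fin.consEquiv fun _ => Y).sum_comp, Fintype.sum_prod_type]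
    have : ∀ b : Y, ∑ y : Fin k → Y, w (hits r (Fin.cons a x : Fin (k + 1) → X)
        (Fin.consEquiv (fun _ => Y) (b, y)))
        = (if r a b then 1 else 0) * binomSum d (m - d) k (fun s => w (s + 1))
          + (1 - if r a b then 1 else 0) * binomSum d (m - d) k w := by
      intro b
      have e : ∀ y : Fin k → Y, (Fin.consEquiv (fun _ => Y) (b, y)) = Fin.cons b y := fun _ => rfl
      simp only [e, hits_cons]
      split_ifs
      · simp [ih (fun s => w (s + 1))]
      · simp [ih]
    simp only [this, sum_add_distrib, ← sum_mul, hr, sum_sub_distrib, sum_const, card_univ,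
      nsmul_eq_mul, hY, binomSum, mul_one]

theorem weight_hits_consEquiv {X Y : Type*} (r : X → Y → Prop) [∀ x y, Decidable (r x y)]
    (k : ℕ) (w : ℕ → ℝ) (p : X × (Fin k → X)) (q : Y × (Fin k → Y)) :
    w (hits r (Fin.consEquiv (fun _ => X) p) (Fin.consEquiv (fun _ => Y) q))
      = (if r p.1 q.1 then 1 else 0) * w (hits r p.2 q.2 + 1)
        + (1 - if r p.1 q.1 then 1 else 0) * w (hits r p.2 q.2) := by
  have : hits r (Fin.consEquiv (fun _ => X) p) (Fin.consEquiv (fun _ => Y) q)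
      = hits r p.2 q.2 + if r p.1 q.1 then 1 else 0 := hits_cons r p.1 q.1 p.2 q.2
  rw [this]
  split_ifs <;> simp

/-! ### Norms of the product matrices -/

section Product

variable {X Y : Type*} [Fintype X] [Fintype Y] {r : X → Y → Prop} [∀ x y, Decidable (r x y)]
  {d m : ℝ}

/-- The bound without centring, with d in place of λ. It is needed for the factor W_k[w(·+1) - w]
next to K, whose mean is not removed. -/
theorem opBound_weight_hits (hd : 0 ≤ d) (hm : 0 < m) (hdm : d ≤ m - d)
    (hX : (Fintype.card X : ℝ) = m) (hY : (Fintype.card Y : ℝ) = m)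
    (hrow : ∀ x, ∑ y, ((if r x y then 1 else 0) - d / m) = 0)
    (hcol : ∀ y, ∑ x, ((if r x y then 1 else 0) - d / m) = 0)
    (hK : OpBound (fun x y => (if r x y then 1 else 0) - d / m) d) (k : ℕ) (w : ℕ → ℝ) :
    OpBound (fun (x : Fin k → X) (y : Fin k → Y) => w (hits r x y))
      (binomSum d (m - d) k fun s => |w s|) := by
  have he := hd.trans hdm
  induction k generalizing w with
  | zero => intro g; simp [binomSum, hits, mul_pow]
  | succ k ih =>
    refine OpBound.reindex (Fin.consEquiv fun _ => X) (Fin.consEquiv fun _ => Y) ?_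
    have h := OpBound.tensor hm hX hY hrow hcol hK
      ((ih fun s => d * w (s + 1) + (m - d) * w s).mono
        (binomSum_nonneg hd he k fun _ => abs_nonneg _) (binomSum_abs_combo_le hd he k w))
      (ih fun s => w (s + 1) - w s)
      (mul_nonneg hd (binomSum_nonneg hd he k fun _ => abs_nonneg _))
      (mul_binomSum_abs_diff_le hd hdm k w)
    convert h using 3
    rw [weight_hits_consEquiv r k w]
    field_simp
    ring

theorem opBound_weight_hits_sub (hd : 0 < d) (hm : 0 < m) (hdm : d ≤ m - d)
    (hX : (Fintype.card X : ℝ) = m) (hY : (Fintype.card Y : ℝ) = m)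
    (hrow : ∀ x, ∑ y, ((if r x y then 1 else 0) - d / m) = 0)
    (hcol : ∀ y, ∑ x, ((if r x y then 1 else 0) - d / m) = 0)
    (hK : OpBound (fun x y => (if r x y then 1 else 0) - d / m) d) {σ : ℝ} (hσ : 0 ≤ σ)
    (hKσ : OpBound (fun x y => (if r x y then 1 else 0) - d / m) σ) (k : ℕ) (w : ℕ → ℝ) :
    OpBound (fun (x : Fin k → X) (y : Fin k → Y) =>
        w (hits r x y) - binomSum d (m - d) k w / m ^ k)
      (σ / d * binomSum d (m - d) k fun s => |w s|) := by
  have he := hd.le.trans hdm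
  have hσd : 0 ≤ σ / d := by positivity
  induction k generalizing w with
  | zero =>
    intro g
    simp only [binomSum, hits, univ_eq_empty, filter_empty, card_empty, pow_zero, div_one,
      sub_self, zero_mul, sum_const_zero, ne_eq, OfNat.ofNat_ne_zero, not_false_eq_true, zero_pow]
    positivity
  | succ k ih =>
    refine OpBound.reindex (Fin.consEquiv fun _ => X) (Fin.consEquiv fun _ => Y) ?_
    have h := OpBound.tensor hm hX hY hrow hcol hKσ
      ((ih fun s => d * w (s + 1) + (m - d) * w s).mono
        (mul_nonneg hσd (binomSum_nonneg hd.le he k fun _ => abs_nonneg _))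
        (mul_le_mul_of_nonneg_left (binomSum_abs_combo_le hd.le he k w) hσd))
      (opBound_weight_hits hd.le hm hdm hX hY hrow hcol hK k fun s => w (s + 1) - w s)
      (mul_nonneg hσ (binomSum_nonneg hd.le he k fun _ => abs_nonneg _))
      (by
        have := mul_le_mul_of_nonneg_left (mul_binomSum_abs_diff_le hd.le hdm k w) hσd
        rwa [← mul_assoc, div_mul_cancel₀ _ hd.ne'] at this)
    -- The subtracted mean is constant, so it belongs entirely to the J/m summand.
    convert h using 3
    rw [weight_hits_consEquiv r k w, binomSum_add, binomSum_const_mul, binomSum_const_mul, binomSum]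
    field_simp
    ring

end Product

/-! ### Spectral bounds for the adjacency form -/

section Spectral

variable {V : Type*} [Fintype V] (G : SimpleGraph V) [DecidableRel G.Adj]

theorem quadraticForm_le_degree {d : ℕ} (hreg : G.IsRegularOfDegree d) (v : V → ℝ) :
    v ⬝ᵥ (G.adjMatrix ℝ).mulVec v ≤ d * ∑ i, v i ^ 2 := by
  have hr : ∀ i, ∑ j, G.adjMatrix ℝ i j = d := fun i => by
    simpa [Matrix.mulVec, dotProduct] using
      G.adjMatrix_mulVec_const_apply_of_regular (α := ℝ) (a := 1) hreg (v := i)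
  have hc : ∀ j, ∑ i, G.adjMatrix ℝ i j = d := fun j => by
    rw [← hr j]
    exact sum_congr rfl fun i _ => by simp [G.adj_comm]
  -- Twice the Laplacian form, which is nonnegative.
  have h0 : 0 ≤ ∑ i, ∑ j, G.adjMatrix ℝ i j * (v i - v j) ^ 2 :=
    sum_nonneg fun i _ => sum_nonneg fun j _ => by
      rw [SimpleGraph.adjMatrix_apply]
      split_ifs <;> positivity
  have h1 : ∑ i, ∑ j, G.adjMatrix ℝ i j * v i ^ 2 = d * ∑ i, v i ^ 2 := by
    simp only [← sum_mul, hr, mul_sum]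
  have h2 : ∑ i, ∑ j, G.adjMatrix ℝ i j * v j ^ 2 = d * ∑ i, v i ^ 2 := by
    rw [sum_comm]
    simp only [← sum_mul, hc, mul_sum]
  have h3 : v ⬝ᵥ (G.adjMatrix ℝ).mulVec v = ∑ i, ∑ j, G.adjMatrix ℝ i j * (v i * v j) := by
    simp only [Matrix.mulVec, dotProduct, mul_sum]
    exact sum_congr rfl fun _ _ => sum_congr rfl fun _ _ => by ring
  have h4 : ∑ i, ∑ j, G.adjMatrix ℝ i j * (v i - v j) ^ 2
      = ∑ i, ∑ j, G.adjMatrix ℝ i j * v i ^ 2 + ∑ i, ∑ j, G.adjMatrix ℝ i j * v j ^ 2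
        - 2 * ∑ i, ∑ j, G.adjMatrix ℝ i j * (v i * v j) := by
    simp only [mul_sum, ← sum_add_distrib, ← sum_sub_distrib]
    exact sum_congr rfl fun _ _ => sum_congr rfl fun _ _ => by ring
  linarith

variable [DecidableEq V]

/-- When λ₂ < d, every eigenvector but the top one has eigenvalue different from d, hence is
orthogonal to the constants. The top one is then parallel to them and orthogonal to v. -/
theorem quadraticForm_le_eigenvalue_one {d : ℕ} (hreg : G.IsRegularOfDegree d)
    (hV : 1 < Fintype.card V) (v : V → ℝ) (hv : ∑ i, v i = 0) (hlt : eigenvalue G 1 < d) :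
    v ⬝ᵥ (G.adjMatrix ℝ).mulVec v ≤ eigenvalue G 1 * ∑ i, v i ^ 2 := by
  have hA := G.isHermitian_adjMatrix (R := ℝ)
  let b : V → V → ℝ := fun i => (hA.eigenvectorBasis i).ofLp
  have parseval : ∀ x y : V → ℝ, ∑ i, (b i ⬝ᵥ x) * (b i ⬝ᵥ y) = x ⬝ᵥ y := fun x y => by
    have := hA.eigenvectorBasis.sum_inner_mul_inner (WithLp.toLp 2 x) (WithLp.toLp 2 y)
    simp only [EuclideanSpace.inner_eq_star_dotProduct, star_trivial] at this
    rw [dotProduct_comm x y, ← this]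
    exact sum_congr rfl fun i _ => by rw [dotProduct_comm y]
  have hAb : ∀ i (x : V → ℝ), b i ⬝ᵥ (G.adjMatrix ℝ).mulVec x = hA.eigenvalues i * (b i ⬝ᵥ x) := by
    intro i x
    have hT : (G.adjMatrix ℝ).transpose = G.adjMatrix ℝ := G.transpose_adjMatrix
    rw [Matrix.dotProduct_mulVec, ← Matrix.mulVec_transpose, hT]
    simp only [b]
    rw [hA.mulVec_eigenvectorBasis, smul_dotProduct, smul_eq_mul]
  obtain ⟨e, he⟩ : ∃ e : V ≃ Fin (Fintype.card V), ∀ i, hA.eigenvalues i = hA.eigenvalues₀ (e i) :=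
    ⟨_, fun _ => rfl⟩
  set i₀ : V := e.symm ⟨0, by omega⟩ with hi₀
  have hle : ∀ i, i ≠ i₀ → hA.eigenvalues i ≤ eigenvalue G 1 := by
    intro i hi
    rw [he, eigenvalue, dif_pos hV]
    refine hA.eigenvalues₀_antitone (Fin.mk_le_of_le_val (Nat.one_le_iff_ne_zero.2 fun h => hi ?_))
    rw [hi₀, Equiv.eq_symm_apply]
    exact Fin.ext h
  have hone : (G.adjMatrix ℝ).mulVec (Function.const V 1) = (d : ℝ) • Function.const V (1 : ℝ) := by
    ext i
    rw [G.adjMatrix_mulVec_const_apply_of_regular hreg]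
    simp
  have hb1 : ∀ i, i ≠ i₀ → b i ⬝ᵥ Function.const V 1 = 0 := by
    intro i hi
    have h := hAb i (Function.const V 1)
    rw [hone, dotProduct_smul, smul_eq_mul] at h
    have h' : ((d : ℝ) - hA.eigenvalues i) * (b i ⬝ᵥ Function.const V 1) = 0 := by linarith
    exact (mul_eq_zero.1 h').resolve_left (by linarith [hle i hi])
  have hb0 : b i₀ ⬝ᵥ Function.const V 1 ≠ 0 := by
    intro h0
    have h := parseval (Function.const V 1) (Function.const V 1)
    rw [sum_eq_zero] at h
    · have h' : (0 : ℝ) = Fintype.card V := by simpa [dotProduct] using h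
      have : 0 = Fintype.card V := by exact_mod_cast h'
      omega
    · intro i _
      by_cases hi : i = i₀
      · rw [hi, h0, zero_mul]
      · rw [hb1 i hi, zero_mul]
  have hbv : b i₀ ⬝ᵥ v = 0 := by
    have h := parseval v (Function.const V 1)
    rw [sum_eq_single i₀ (fun i _ hi => by rw [hb1 i hi, mul_zero]) (by simp)] at h
    have hv' : v ⬝ᵥ Function.const V 1 = 0 := by simpa [dotProduct] using hv
    rw [hv'] at h
    exact (mul_eq_zero.1 h).resolve_right hb0
  have hvv : ∑ i, v i ^ 2 = v ⬝ᵥ v := sum_congr rfl fun _ _ => sq _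
  rw [hvv, ← parseval v v, ← parseval v, mul_sum]
  refine sum_le_sum fun i _ => ?_
  rw [hAb]
  by_cases hi : i = i₀
  · simp [hi, hbv]
  · nlinarith [mul_le_mul_of_nonneg_right (hle i hi) (mul_self_nonneg (b i ⬝ᵥ v))]

/-- If λ₂ ≥ d, the degree bound already suffices. -/
theorem quadraticForm_le_bipartiteLambda {d : ℕ} (hreg : G.IsRegularOfDegree d)
    (hV : 1 < Fintype.card V) (v : V → ℝ) (hv : ∑ i, v i = 0) :
    v ⬝ᵥ (G.adjMatrix ℝ).mulVec v ≤ bipartiteLambda G * ∑ i, v i ^ 2 := by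
  have hs : 0 ≤ ∑ i, v i ^ 2 := sum_nonneg fun _ _ => sq_nonneg _
  have hl : eigenvalue G 1 ≤ bipartiteLambda G := le_max_left _ _
  rcases lt_or_ge (eigenvalue G 1) d with h | h
  · exact (quadraticForm_le_eigenvalue_one G hreg hV v hv h).trans (by gcongr)
  · exact (quadraticForm_le_degree G hreg v).trans (mul_le_mul_of_nonneg_right (h.trans hl) hs)

theorem bipartiteLambda_nonneg : 0 ≤ bipartiteLambda G := (abs_nonneg _).trans (le_max_right _ _)

end Spectral

/-! ### From the quadratic form to the biadjacency matrix -/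

theorem opBound_sub_mean {α β : Type*} [Fintype α] [Fintype β] {M : α → β → ℝ} {a m c : ℝ}
    (hc : 0 ≤ c) (hm : 0 < m) (hβ : (Fintype.card β : ℝ) = m)
    (hrow : ∀ x, ∑ y, (M x y - a) = 0) (hcol : ∀ y, ∑ x, (M x y - a) = 0)
    (h : ∀ (f : α → ℝ) (g : β → ℝ), ∑ x, f x = 0 → ∑ y, g y = 0 →
      2 * ∑ x, f x * ∑ y, M x y * g y ≤ c * (∑ x, f x ^ 2 + ∑ y, g y ^ 2)) :
    OpBound (fun x y => M x y - a) c := by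
  intro g
  set μ : ℝ := (∑ y, g y) / m with hμ
  have hgμ : ∑ y, g y = m * μ := by rw [hμ]; field_simp
  have hg0 : ∑ y, (g y - μ) = 0 := by
    rw [sum_sub_distrib, hgμ, sum_const, card_univ, nsmul_eq_mul, hβ, sub_self]
  set f : α → ℝ := fun x => ∑ y, (M x y - a) * g y with hf
  have hf0 : ∑ x, f x = 0 := by
    rw [sum_comm]
    simp only [← sum_mul, hcol, zero_mul, sum_const_zero]
  have hfM : ∀ x, ∑ y, M x y * (g y - μ) = f x := by
    intro x
    have e1 : ∑ y, M x y * (g y - μ)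
        = f x - (∑ y, (M x y - a)) * μ + a * ∑ y, (g y - μ) := by
      rw [sum_mul, mul_sum, ← sum_sub_distrib, ← sum_add_distrib]
      exact sum_congr rfl fun _ _ => by ring
    rw [e1, hrow, hg0]
    ring
  have hG : ∑ y, (g y - μ) ^ 2 ≤ ∑ y, g y ^ 2 := by
    have : ∑ y, (g y - μ) ^ 2 = ∑ y, g y ^ 2 - m * μ ^ 2 := by
      simp only [sub_sq, sum_add_distrib, sum_sub_distrib, ← mul_sum, ← sum_mul, hgμ, sum_const,
        card_univ, nsmul_eq_mul, hβ]
      ring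
    rw [this]
    have : 0 ≤ m * μ ^ 2 := by positivity
    linarith
  -- Test the form on s·f, where f is the image of g; s = 1/c is the optimal scaling, and s = 1
  -- settles c = 0.
  have key : ∀ s : ℝ, 2 * (s * ∑ x, f x ^ 2) ≤ c * (s ^ 2 * ∑ x, f x ^ 2 + ∑ y, g y ^ 2) := by
    intro s
    have := h (fun x => s * f x) (fun y => g y - μ) (by rw [← mul_sum, hf0, mul_zero]) hg0
    simp only [hfM, mul_pow, ← mul_sum, mul_assoc, ← sq] at this
    exact this.trans (by gcongr)
  rcases hc.eq_or_lt with rfl | hc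
  · have := key 1
    linarith
  · have h1 := mul_le_mul_of_nonneg_left (key c⁻¹) hc.le
    have e1 : c * (2 * (c⁻¹ * ∑ x, f x ^ 2)) = 2 * ∑ x, f x ^ 2 := by field_simp
    have e2 : c * (c * (c⁻¹ ^ 2 * ∑ x, f x ^ 2 + ∑ y, g y ^ 2))
        = ∑ x, f x ^ 2 + c ^ 2 * ∑ y, g y ^ 2 := by field_simp
    rw [e1, e2] at h1
    linarith

theorem not_adj_inl_inl {X Y : Type*} {G : SimpleGraph (X ⊕ Y)}
    (hbip : G ≤ completeBipartiteGraph X Y) (x x' : X) :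
    ¬G.Adj (.inl x) (.inl x') := fun h => by simpa using hbip h

theorem not_adj_inr_inr {X Y : Type*} {G : SimpleGraph (X ⊕ Y)}
    (hbip : G ≤ completeBipartiteGraph X Y) (y y' : Y) :
    ¬G.Adj (.inr y) (.inr y') := fun h => by simpa using hbip h

theorem bgp_adj_inl_inr {X Y : Type*} {G : SimpleGraph (X ⊕ Y)} [DecidableRel G.Adj] (k t : ℕ)
    (x : Fin k → X) (y : Fin k → Y) :
    (bgp G k t).Adj (.inl x) (.inr y) ↔ t ≤ hits (fun x y => G.Adj (.inl x) (.inr y)) x y :=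
  Iff.rfl

theorem edgeCount_bgp {X Y : Type*} {G : SimpleGraph (X ⊕ Y)} [DecidableRel G.Adj] (k t : ℕ)
    (S : Finset (Fin k → X)) (T : Finset (Fin k → Y)) :
    (edgeCount (bgp G k t) (S.map .inl) (T.map .inr) : ℝ)
      = ∑ x ∈ S, ∑ y ∈ T,
        if t ≤ hits (fun x y => G.Adj (.inl x) (.inr y)) x y then (1 : ℝ) else 0 := by
  rw [edgeCount, SimpleGraph.interedges, Rel.interedges, ← sum_boole, sum_product, sum_map]
  refine sum_congr rfl fun x _ => ?_
  rw [sum_map]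
  simp only [Function.Embedding.inl_apply, Function.Embedding.inr_apply, bgp_adj_inl_inr]

section Bipartite

variable {X Y : Type*} [Fintype X] [Fintype Y]
  {G : SimpleGraph (X ⊕ Y)} [DecidableRel G.Adj]

theorem sum_adj_inl (hbip : G ≤ completeBipartiteGraph X Y) {d : ℕ}
    (hreg : G.IsRegularOfDegree d) (x : X) :
    ∑ y, (if G.Adj (.inl x) (.inr y) then (1 : ℝ) else 0) = d := by
  have h := G.adjMatrix_mulVec_const_apply_of_regular (α := ℝ) (a := 1) hreg (v := .inl x)
  simpa only [Matrix.mulVec, dotProduct, Fintype.sum_sum_type, SimpleGraph.adjMatrix_apply,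
    not_adj_inl_inl hbip, Function.const_apply, mul_one, if_false, sum_const_zero, zero_add]
    using h

theorem sum_adj_inr (hbip : G ≤ completeBipartiteGraph X Y) {d : ℕ}
    (hreg : G.IsRegularOfDegree d) (y : Y) :
    ∑ x, (if G.Adj (.inl x) (.inr y) then (1 : ℝ) else 0) = d := by
  have h := G.adjMatrix_mulVec_const_apply_of_regular (α := ℝ) (a := 1) hreg (v := .inr y)
  simpa only [Matrix.mulVec, dotProduct, Fintype.sum_sum_type, SimpleGraph.adjMatrix_apply,
    not_adj_inr_inr hbip, Function.const_apply, mul_one, if_false, sum_const_zero, add_zero,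
    G.adj_comm (.inr y)] using h

theorem card_left_eq_card_right (hbip : G ≤ completeBipartiteGraph X Y) {d : ℕ} (hd : 0 < d)
    (hreg : G.IsRegularOfDegree d) : Fintype.card X = Fintype.card Y := by
  have h : ∑ x : X, (d : ℝ) = ∑ y : Y, (d : ℝ) := by
    rw [← sum_congr rfl fun x _ => sum_adj_inl hbip hreg x,
      ← sum_congr rfl fun y _ => sum_adj_inr hbip hreg y, sum_comm]
  simp only [sum_const, card_univ, nsmul_eq_mul] at h
  exact_mod_cast mul_right_cancel₀ (Nat.cast_ne_zero.2 hd.ne') h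

theorem dotProduct_adjMatrix_mulVec_sumElim (hbip : G ≤ completeBipartiteGraph X Y) (f : X → ℝ)
    (g : Y → ℝ) :
    Sum.elim f g ⬝ᵥ (G.adjMatrix ℝ).mulVec (Sum.elim f g)
      = 2 * ∑ x, f x * ∑ y, (if G.Adj (.inl x) (.inr y) then 1 else 0) * g y := by
  have h : ∑ y, g y * ∑ x, (if G.Adj (.inr y) (.inl x) then 1 else 0) * f x
      = ∑ x, f x * ∑ y, (if G.Adj (.inl x) (.inr y) then 1 else 0) * g y := by
    simp only [mul_sum]
    rw [sum_comm]
    refine sum_congr rfl fun x _ => sum_congr rfl fun y _ => ?_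
    simp only [G.adj_comm (.inr y)]
    ring
  have h' : Sum.elim f g ⬝ᵥ (G.adjMatrix ℝ).mulVec (Sum.elim f g)
      = ∑ x, f x * ∑ y, (if G.Adj (.inl x) (.inr y) then 1 else 0) * g y
        + ∑ y, g y * ∑ x, (if G.Adj (.inr y) (.inl x) then 1 else 0) * f x := by
    simp only [Matrix.mulVec, dotProduct, Fintype.sum_sum_type, Sum.elim_inl, Sum.elim_inr,
      SimpleGraph.adjMatrix_apply, not_adj_inl_inl hbip, not_adj_inr_inr hbip, if_false, zero_mul,
      sum_const_zero, zero_add, add_zero]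
  rw [h', h, two_mul]

/-- On v = (f, g) the form is twice the bilinear form of the biadjacency matrix, so an upper bound
alone controls the norm. -/
theorem opBound_biadjacency (hbip : G ≤ completeBipartiteGraph X Y) {a m c : ℝ}
    (hc : 0 ≤ c) (hm : 0 < m) (hY : (Fintype.card Y : ℝ) = m)
    (hrow : ∀ x, ∑ y, ((if G.Adj (.inl x) (.inr y) then 1 else 0) - a) = 0)
    (hcol : ∀ y, ∑ x, ((if G.Adj (.inl x) (.inr y) then 1 else 0) - a) = 0)
    (h : ∀ v : X ⊕ Y → ℝ, ∑ i, v i = 0 →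
      v ⬝ᵥ (G.adjMatrix ℝ).mulVec v ≤ c * ∑ i, v i ^ 2) :
    OpBound (fun (x : X) (y : Y) => (if G.Adj (.inl x) (.inr y) then 1 else 0) - a) c := by
  refine opBound_sub_mean hc hm hY hrow hcol fun f g hf hg => ?_
  have := h (Sum.elim f g) (by simp [hf, hg])
  rw [dotProduct_adjMatrix_mulVec_sumElim hbip] at this
  simpa using this

theorem bgp_degree (hbip : G ≤ completeBipartiteGraph X Y) {n d : ℕ}
    (hX : (Fintype.card X : ℝ) = n / 2) (hY : (Fintype.card Y : ℝ) = n / 2)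
    (hreg : G.IsRegularOfDegree d) (k t : ℕ) (v : (Fin k → X) ⊕ (Fin k → Y)) :
    ((bgp G k t).degree v : ℝ) = d₂ n d k t := by
  have hdeg : ((bgp G k t).degree v : ℝ) = ∑ u, if (bgp G k t).Adj v u then (1 : ℝ) else 0 := by
    rw [← SimpleGraph.card_neighborFinset_eq_degree, SimpleGraph.neighborFinset_eq_filter,
      sum_boole]
  rw [hdeg, Fintype.sum_sum_type, d₂_eq_binomSum]
  rcases v with x | y
  · rw [← sum_weight_hits (fun x y => G.Adj (.inl x) (.inr y)) hY (sum_adj_inl hbip hreg) k _ x]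
    have : ∀ x', ¬(bgp G k t).Adj (.inl x) (.inl x') := fun _ h => h
    simp only [this, if_false, sum_const_zero, zero_add, bgp_adj_inl_inr]
  · rw [← sum_weight_hits (fun y x => G.Adj (.inl x) (.inr y)) hX (sum_adj_inr hbip hreg) k _ y]
    have : ∀ y', ¬(bgp G k t).Adj (.inr y) (.inr y') := fun _ h => h
    simp only [this, if_false, sum_const_zero, add_zero, (bgp G k t).adj_comm (.inr y),
      bgp_adj_inl_inr]
    rfl

end Bipartite

end BipartiteProduct

/-! ### The mixing bound -/

theorem mainTheorem6 {X Y : Type*} [Fintype X] [Fintype Y] [DecidableEq X] [DecidableEq Y]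
    (G : SimpleGraph (X ⊕ Y)) [DecidableRel G.Adj]
    (hbip : G ≤ completeBipartiteGraph X Y)
    (n d k t : ℕ) (hn : Fintype.card (X ⊕ Y) = n) (hd : 0 < d)
    (hreg : G.IsRegularOfDegree d) (hdn : (d : ℝ) ≤ (n : ℝ) / 4) :
    (∀ v, ((BipartiteProduct.bgp G k t).degree v : ℝ) = BipartiteProduct.d₂ n d k t) ∧
    ∀ (S : Finset (Fin k → X)) (T : Finset (Fin k → Y)),
      |(BipartiteProduct.edgeCount (BipartiteProduct.bgp G k t)
            (S.map Function.Embedding.inl) (T.map Function.Embedding.inr) : ℝ)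
          - BipartiteProduct.mu ((Fin k → X) ⊕ (Fin k → Y)) (BipartiteProduct.d₂ n d k t)
            (S.map Function.Embedding.inl) (T.map Function.Embedding.inr)|
        ≤ BipartiteProduct.bipartiteLambda G / (d : ℝ) * BipartiteProduct.d₂ n d k t
            * √((S.card : ℝ) * (T.card : ℝ)) := by
  open BipartiteProduct Finset in
  have hXY := card_left_eq_card_right hbip hd hreg
  have hn' : (Fintype.card X : ℝ) + Fintype.card Y = n := by
    rw [← hn, Fintype.card_sum, Nat.cast_add]
  have hXYr : (Fintype.card X : ℝ) = Fintype.card Y := congrArg _ hXY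
  have hX : (Fintype.card X : ℝ) = n / 2 := by linarith
  have hY : (Fintype.card Y : ℝ) = n / 2 := by linarith
  have hdr : (0 : ℝ) < d := Nat.cast_pos.2 hd
  have hm : (0 : ℝ) < (n : ℝ) / 2 := by linarith
  refine ⟨bgp_degree hbip hX hY hreg k t, fun S T => ?_⟩
  have hV : 1 < Fintype.card (X ⊕ Y) := by
    have : (1 : ℝ) ≤ d := Nat.one_le_cast.2 hd
    have : (1 : ℝ) < n := by linarith
    rw [hn]
    exact_mod_cast this
  have hrow : ∀ x : X, ∑ y : Y,
      ((if G.Adj (.inl x) (.inr y) then 1 else 0) - (d : ℝ) / ((n : ℝ) / 2)) = 0 := fun x => by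
    rw [sum_sub_distrib, sum_adj_inl hbip hreg, sum_const, card_univ, nsmul_eq_mul, hY,
      mul_div_cancel₀ _ hm.ne', sub_self]
  have hcol : ∀ y : Y, ∑ x : X,
      ((if G.Adj (.inl x) (.inr y) then 1 else 0) - (d : ℝ) / ((n : ℝ) / 2)) = 0 := fun y => by
    rw [sum_sub_distrib, sum_adj_inr hbip hreg, sum_const, card_univ, nsmul_eq_mul, hX,
      mul_div_cancel₀ _ hm.ne', sub_self]
  have hK := opBound_biadjacency hbip hdr.le hm hY hrow hcol
    fun v _ => quadraticForm_le_degree G hreg v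
  have hKl := opBound_biadjacency hbip (bipartiteLambda_nonneg G) hm hY hrow hcol
    (quadraticForm_le_bipartiteLambda G hreg hV)
  have hde : (d : ℝ) ≤ (n : ℝ) / 2 - d := by linarith
  have hw : ∀ s : ℕ, |(if t ≤ s then (1 : ℝ) else 0)| = if t ≤ s then 1 else 0 := fun s => by
    split_ifs <;> simp
  have hB := opBound_weight_hits_sub (r := fun x y => G.Adj (.inl x) (.inr y)) hdr hm hde hX hY
    hrow hcol hK (bipartiteLambda_nonneg G) hKl k fun s => if t ≤ s then 1 else 0
  simp only [hw, ← d₂_eq_binomSum] at hB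
  -- A degree is nonnegative, and a vertex exists because X is nonempty.
  have hd₂ : 0 ≤ d₂ n d k t := by
    rw [← bgp_degree hbip hX hY hreg k t (.inl fun _ => Classical.choice ?_)]
    · positivity
    · rw [← Fintype.card_pos_iff]
      exact_mod_cast hX ▸ hm
  have h := hB.abs_sum_le
    (mul_nonneg (div_nonneg (bipartiteLambda_nonneg G) hdr.le) hd₂) S T
  -- Both parts have m^k vertices, so N/2 = m^k and μ is the subtracted mean entry summed over S ×
  -- T.
  have hmu : mu ((Fin k → X) ⊕ (Fin k → Y)) (d₂ n d k t) (S.map .inl) (T.map .inr)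
      = #S * (#T * (d₂ n d k t / ((n : ℝ) / 2) ^ k)) := by
    simp only [mu, card_map, Fintype.card_sum, Fintype.card_fun, Fintype.card_fin, Nat.cast_add,
      Nat.cast_pow, hX, hY, add_self_div_two]
    ring
  simp only [sum_sub_distrib, sum_const, nsmul_eq_mul] at h
  rwa [edgeCount_bgp, hmu]
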